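/- Let $G$ be a finite simple graph. Then the circular chromatic number of $G$ is less than $3$ if and only if $G$ is a spanning subgraph of a triangle-free graph $H$ whose complement $\overline H$ is anti-even-signable. Equivalently, in terms of edge-maximal graphs: $G$ is edge-maximal (no edge can be added on the same vertex set without leaving the class) among the graphs with circular chromatic number less than $3$ if and only if it is edge-maximal among the triangle-free graphs with anti-even-signable complement. Moreover, the forward implication of the first statement also holds for countably infinite graphs: if $G$ is a countable graph with circular chromatic number less than $3$, then $G$ is a spanning subgraph of a triangle-free graph whose complement is anti-even-signable. Here a graph is anti-even-signable if its edges can be labelled by elements of $\mathbb Z/2$ so that the sum of the labels is $0$ on every triangle and $1$ on every induced cycle of length at least $4$. The circular chromatic number of $G$ is the infimum of the real numbers $r\ge 1$ for which there is a map $c\colon V(G)\to[0,r)$ with $1\le |c(u)-c(v)|\le r-1$ for every edge $uv$ (and $\infty$ if there is no such $r$). -/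

import Mathlib

open scoped NNReal ENNReal

namespace SimpleGraph

variable {V : Type*}

/-- A circular `r`-colouring of `G`: a map `c` from the vertices to the interval `[0, r)` such that
adjacent vertices receive colours at distance at least `1` on the circle of circumference `r`,
that is, `1 ≤ |c u - c v| ≤ r - 1`. -/
def IsCircularColoring (G : SimpleGraph V) (r : ℝ≥0) (c : V → ℝ) : Prop :=
  (∀ v, 0 ≤ c v ∧ c v < r) ∧ ∀ u v, G.Adj u v → 1 ≤ |c u - c v| ∧ |c u - c v| ≤ r - 1

/-- The circular chromatic number of `G`: the infimum of the real numbers `r ≥ 1` such that `G` has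
a circular `r`-colouring. It is `∞` if there is no such `r`. -/
noncomputable def circularChromaticNumber (G : SimpleGraph V) : ℝ≥0∞ :=
  ⨅ (r : ℝ≥0) (_ : 1 ≤ r ∧ ∃ c, G.IsCircularColoring r c), (r : ℝ≥0∞)

/-- The collection of all induced cycles of `G`: the induced subgraphs of `G` that are isomorphic
to a cycle of some length `n ≥ 3`. -/
def inducedCycles (G : SimpleGraph V) : Set G.Subgraph :=
  {C | C.IsInduced ∧ ∃ n, 3 ≤ n ∧ Nonempty (C.coe ≃g cycleGraph n)}

/-- The value `σ(H) = ∑ e ∈ E(H), σ(e)` of an edge labelling `σ` on a subgraph `H` of `G`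
with finitely many edges. -/
noncomputable def EdgeLabeling.subgraphSum {G : SimpleGraph V} (σ : G.EdgeLabeling (ZMod 2))
    (H : G.Subgraph) : ZMod 2 :=
  ∑ᶠ e : H.edgeSet, σ ⟨e.1, H.edgeSet_subset e.2⟩

/-- The labelling `σ` of `G` is `β`-balancing if `σ(C) = β(C)` for every induced cycle `C`. -/
def IsBalancing {G : SimpleGraph V} (β : G.inducedCycles → ZMod 2)
    (σ : G.EdgeLabeling (ZMod 2)) : Prop :=
  ∀ C : G.inducedCycles, σ.subgraphSum C.1 = β C

/-- `G` is `β`-balanceable if it has a `β`-balancing labelling. -/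
def IsBalanceable (G : SimpleGraph V) (β : G.inducedCycles → ZMod 2) : Prop :=
  ∃ σ : G.EdgeLabeling (ZMod 2), IsBalancing β σ

/-- The function on induced cycles that is `0` on triangles and `1` on all longer cycles. -/
noncomputable def antiEvenSign (G : SimpleGraph V) (C : G.inducedCycles) : ZMod 2 :=
  if C.1.verts.ncard = 3 then 0 else 1

/-- `G` is anti-even-signable: its edges can be labelled by elements of `ℤ/2` so that the labels
sum to `0` on every triangle and to `1` on every induced cycle of length at least `4`. -/
def AntiEvenSignable (G : SimpleGraph V) : Prop :=
  G.IsBalanceable G.antiEvenSign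

end SimpleGraph

namespace SimpleGraph

variable {V : Type*} {G : SimpleGraph V}

/-! Both conditions describe points on a circle cut into three sectors.

Forward: an `r`-colouring with `r < 3`, stretched to a circle of length 3, puts adjacent vertices at
distance more than 1. Sector and height within the sector then embed `G` in a `sectorGraph`, which
is triangle-free. Labelling a non-edge by whether it crosses one fixed sector border signs the
complement, since the long induced cycles there wind around the circle once
(`sectorGraph_compl_antiEvenSignable`).

Converse, for finite `H`: switching normalises the signing at a vertex `v` of maximum degree, and
the labels then split the vertices into three independent classes (`IsCoSign.exists_coloring`). The
square condition makes each pair of classes 2K₂-free, so the arcs from each class to the next are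
acyclic (`exists_lt_of_colorArc`). A height function decreasing along the arcs shifts the vertices
inside their sectors and gives a colouring with `r < 3`. Only cycles of length 3, 4 and 5 matter, as
longer ones in the complement would force a triangle in `H`. -/

lemma cliqueFree_three_iff_forall_adj :
    G.CliqueFree 3 ↔ ∀ a b c, G.Adj a b → G.Adj b c → ¬ G.Adj c a := by
  classical
  constructor
  · intro h a b c hab hbc hca
    exact h {a, b, c} (is3Clique_triple_iff.2 ⟨hab, hca.symm, hbc⟩)
  · intro h s hs
    obtain ⟨a, b, c, hab, hac, hbc, -⟩ := is3Clique_iff.1 hs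
    exact h a b c hab hbc hac.symm

/-! ### Signings as sums around embedded cycles -/

/-- The label of the edge `uv`, or `0` if `u` and `v` are not adjacent. -/
noncomputable def EdgeLabeling.value (σ : G.EdgeLabeling (ZMod 2)) (u v : V) : ZMod 2 :=
  open Classical in if h : G.Adj u v then σ.get u v h else 0

lemma EdgeLabeling.value_of_adj (σ : G.EdgeLabeling (ZMod 2)) {u v : V} (h : G.Adj u v) :
    σ.value u v = σ ⟨s(u, v), h⟩ := by
  simp [value, h, EdgeLabeling.get]

lemma EdgeLabeling.value_comm (σ : G.EdgeLabeling (ZMod 2)) (u v : V) :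
    σ.value u v = σ.value v u := by
  by_cases h : G.Adj u v
  · simp only [value, h, h.symm, dite_true]
    exact (EdgeLabeling.get_comm _ _ _)
  · have h' : ¬ G.Adj v u := fun h' => h h'.symm
    simp only [value, h, h', dite_false]

lemma EdgeLabeling.value_self (σ : G.EdgeLabeling (ZMod 2)) (u : V) : σ.value u u = 0 := by
  simp [value]

lemma cycleGraph_adj_add_one {n : ℕ} (i : Fin (n + 3)) : (cycleGraph (n + 3)).Adj i (i + 1) := by
  rw [cycleGraph_adj]
  right
  abel

lemma EdgeLabeling.subgraphSum_eq_sum (σ : G.EdgeLabeling (ZMod 2)) {C : G.Subgraph} {n : ℕ}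
    (e : cycleGraph (n + 3) ≃g C.coe) :
    σ.subgraphSum C = ∑ i : Fin (n + 3), σ.value (e i) (e (i + 1)) := by
  have hadj (i : Fin (n + 3)) : C.Adj (e i) (e (i + 1)) :=
    e.map_adj_iff.2 (cycleGraph_adj_add_one i)
  let φ : Fin (n + 3) → C.edgeSet := fun i => ⟨s((e i : V), (e (i + 1) : V)), hadj i⟩
  have hφ : Function.Bijective φ := by
    constructor
    · intro i j hij
      have h := congrArg Subtype.val hij
      simp only [φ, Sym2.eq_iff, Subtype.coe_inj, e.injective.eq_iff] at h
      rcases h with h | ⟨h1, h2⟩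
      · exact h.1
      · exfalso
        -- Two indices giving the same edge reversed would force `2 = 0` modulo `n + 3`.
        rw [h1, add_assoc] at h2
        have h3 : (1 + 1 : Fin (n + 3)) = 0 := by simpa using h2
        have h4 := congrArg Fin.val h3
        rw [Fin.val_add] at h4
        simp [Nat.mod_eq_of_lt (show 2 < n + 3 by omega)] at h4
    · rintro ⟨x, hx⟩
      induction x using Sym2.inductionOn with
      | _ u v =>
      have huv : C.Adj u v := hx
      obtain ⟨i, hi⟩ := e.surjective ⟨u, C.edge_vert huv⟩
      obtain ⟨j, hj⟩ := e.surjective ⟨v, C.edge_vert huv.symm⟩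
      have hij : (cycleGraph (n + 3)).Adj i j := by
        rw [← e.map_adj_iff, hi, hj]; exact huv
      rw [cycleGraph_adj] at hij
      rcases hij with h | h
      · refine ⟨j, Subtype.ext ?_⟩
        have : j + 1 = i := by rw [← h]; abel
        simp [φ, this, hi, hj, Sym2.eq_swap]
      · refine ⟨i, Subtype.ext ?_⟩
        have : i + 1 = j := by rw [← h]; abel
        simp [φ, this, hi, hj]
  rw [EdgeLabeling.subgraphSum, ← finsum_eq_of_bijective φ hφ (fun i => rfl),
    finsum_eq_sum_of_fintype]
  refine Finset.sum_congr rfl fun i _ => ?_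
  rw [σ.value_of_adj (C.adj_sub (hadj i))]

/-- Being balancing for the anti-even sign, expressed through embedded cycle graphs. -/
lemma isBalancing_antiEvenSign_iff {σ : G.EdgeLabeling (ZMod 2)} :
    IsBalancing G.antiEvenSign σ ↔ ∀ (n : ℕ) (f : cycleGraph (n + 3) ↪g G),
      ∑ i : Fin (n + 3), σ.value (f i) (f (i + 1)) = if n = 0 then 0 else 1 := by
  have key {C : G.inducedCycles} {n : ℕ} (e : cycleGraph (n + 3) ≃g C.1.coe) :
      G.antiEvenSign C = if n = 0 then 0 else 1 := by
    have : C.1.verts.ncard = n + 3 := by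
      rw [← Nat.card_coe_set_eq, ← Nat.card_congr e.toEquiv, Nat.card_eq_fintype_card,
        Fintype.card_fin]
    simp [antiEvenSign, this]
  constructor
  · intro h n f
    let C : G.inducedCycles := ⟨f.toCopy.toSubgraph, by
      simp [Subgraph.IsInduced, Relation.map_apply_apply, f.injective], n + 3, by omega,
      ⟨f.toCopy.isoToSubgraph.symm⟩⟩
    rw [← key (C := C) f.toCopy.isoToSubgraph, ← h C,
      σ.subgraphSum_eq_sum (C := C.1) f.toCopy.isoToSubgraph]
    rfl
  · rintro h ⟨C, hC, n, hn, ⟨e⟩⟩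
    obtain ⟨m, rfl⟩ : ∃ m, n = m + 3 := ⟨n - 3, by omega⟩
    rw [key (n := m) e.symm, σ.subgraphSum_eq_sum (C := C) e.symm]
    exact h m ⟨⟨fun i => (e.symm i : V), Subtype.val_injective.comp e.symm.injective⟩, by
      intro a b
      change G.Adj (e.symm a) (e.symm b) ↔ _
      rw [← e.symm.map_adj_iff]
      exact hC.adj.symm⟩

namespace IsBalancing

variable {σ : G.EdgeLabeling (ZMod 2)}

lemma triangle (hσ : IsBalancing G.antiEvenSign σ) {a b c : V}
    (hab : G.Adj a b) (hbc : G.Adj b c) (hca : G.Adj c a) :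
    σ.value a b + σ.value b c + σ.value c a = 0 := by
  have hinj : Function.Injective ![a, b, c] := by
    intro i j
    fin_cases i <;> fin_cases j <;> simp [hab.ne, hab.ne', hbc.ne, hbc.ne', hca.ne, hca.ne']
  have h := isBalancing_antiEvenSign_iff.1 hσ 0 ⟨⟨![a, b, c], hinj⟩, by
    intro i j
    fin_cases i <;> fin_cases j <;>
      simp [cycleGraph_three_eq_top, hab, hab.symm, hbc, hbc.symm, hca, hca.symm]⟩
  simpa [Fin.sum_univ_succ, add_assoc] using h

lemma square (hσ : IsBalancing G.antiEvenSign σ) {a b c d : V}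
    (hab : G.Adj a b) (hbc : G.Adj b c) (hcd : G.Adj c d) (hda : G.Adj d a)
    (hac : Gᶜ.Adj a c) (hbd : Gᶜ.Adj b d) :
    σ.value a b + σ.value b c + σ.value c d + σ.value d a = 1 := by
  have hinj : Function.Injective ![a, b, c, d] := by
    intro i j
    fin_cases i <;> fin_cases j <;> simp [hab.ne, hab.ne', hbc.ne, hbc.ne', hcd.ne, hcd.ne',
      hda.ne, hda.ne', hac.ne, hac.ne', hbd.ne, hbd.ne']
  have h := isBalancing_antiEvenSign_iff.1 hσ 1 ⟨⟨![a, b, c, d], hinj⟩, by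
    intro i j
    have h1 := ((compl_adj _ _ _).1 hac).2
    have h2 := ((compl_adj _ _ _).1 hac.symm).2
    have h3 := ((compl_adj _ _ _).1 hbd).2
    have h4 := ((compl_adj _ _ _).1 hbd.symm).2
    fin_cases i <;> fin_cases j <;>
      simp [cycleGraph_adj, hab, hab.symm, hbc, hbc.symm, hcd, hcd.symm, hda, hda.symm,
        h1, h2, h3, h4] <;> decide⟩
  simpa [Fin.sum_univ_succ, add_assoc] using h

lemma pentagon (hσ : IsBalancing G.antiEvenSign σ) {a b c d e : V}
    (hab : G.Adj a b) (hbc : G.Adj b c) (hcd : G.Adj c d) (hde : G.Adj d e) (hea : G.Adj e a)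
    (hac : Gᶜ.Adj a c) (hbd : Gᶜ.Adj b d) (hce : Gᶜ.Adj c e) (hda : Gᶜ.Adj d a)
    (heb : Gᶜ.Adj e b) :
    σ.value a b + σ.value b c + σ.value c d + σ.value d e + σ.value e a = 1 := by
  have hinj : Function.Injective ![a, b, c, d, e] := by
    intro i j
    fin_cases i <;> fin_cases j <;> simp [hab.ne, hab.ne', hbc.ne, hbc.ne', hcd.ne, hcd.ne',
      hde.ne, hde.ne', hea.ne, hea.ne', hac.ne, hac.ne', hbd.ne, hbd.ne', hce.ne, hce.ne',
      hda.ne, hda.ne', heb.ne, heb.ne']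
  have h := isBalancing_antiEvenSign_iff.1 hσ 2 ⟨⟨![a, b, c, d, e], hinj⟩, by
    intro i j
    have h1 := ((compl_adj _ _ _).1 hac).2
    have h2 := ((compl_adj _ _ _).1 hac.symm).2
    have h3 := ((compl_adj _ _ _).1 hbd).2
    have h4 := ((compl_adj _ _ _).1 hbd.symm).2
    have h5 := ((compl_adj _ _ _).1 hce).2
    have h6 := ((compl_adj _ _ _).1 hce.symm).2
    have h7 := ((compl_adj _ _ _).1 hda).2
    have h8 := ((compl_adj _ _ _).1 hda.symm).2
    have h9 := ((compl_adj _ _ _).1 heb).2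
    have h10 := ((compl_adj _ _ _).1 heb.symm).2
    fin_cases i <;> fin_cases j <;>
      simp [cycleGraph_adj, hab, hab.symm, hbc, hbc.symm, hcd, hcd.symm, hde, hde.symm,
        hea, hea.symm, h1, h2, h3, h4, h5, h6, h7, h8, h9, h10] <;> decide⟩
  simpa [Fin.sum_univ_succ, add_assoc] using h

end IsBalancing

/-! ### Sector graphs and the signing of their complements -/

/-- The graph on vertices placed at height `F` in one of three cyclically ordered sectors: vertices
in consecutive sectors are adjacent if the heights increase in the cyclic direction. -/
def sectorGraph {V L : Type*} [LinearOrder L] (col : V → Fin 3) (F : V → L) : SimpleGraph V where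
  Adj u v := (col v = col u + 1 ∧ F u < F v) ∨ (col u = col v + 1 ∧ F v < F u)
  symm := ⟨fun _ _ h => h.symm⟩
  loopless := ⟨fun u h => by
    rcases h with h | h <;> exact lt_irrefl _ h.2⟩

/-- The sign of a pair of sectors, recording whether a short arc between them crosses the border
between the sectors `2` and `0`. -/
def sectorSign (i j : Fin 3) : ZMod 2 :=
  if (i = 0 ∧ j = 2) ∨ (i = 2 ∧ j = 0) then 1 else 0

lemma sectorSign_comm (i j : Fin 3) : sectorSign i j = sectorSign j i := by
  revert i j; decide

/-- The labelling of a graph by the signs of pairs of sectors. -/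
def sectorLabeling {V : Type*} (G : SimpleGraph V) (col : V → Fin 3) : G.EdgeLabeling (ZMod 2) :=
  fun e => Sym2.lift ⟨fun u v => sectorSign (col u) (col v), fun _ _ => sectorSign_comm _ _⟩ e.1

lemma sectorLabeling_value {V : Type*} {G : SimpleGraph V} (col : V → Fin 3) {u v : V}
    (h : G.Adj u v) : (sectorLabeling G col).value u v = sectorSign (col u) (col v) := by
  rw [EdgeLabeling.value_of_adj _ h]
  rfl

lemma sectorSign_triangle (i j k : Fin 3) (h : i = j ∨ j = k ∨ k = i) :
    sectorSign i j + sectorSign j k + sectorSign k i = 0 := by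
  revert i j k; decide

/-- With the two excluded patterns gone, the closed walk `i j k l` meets all three sectors and winds
once, so it crosses the border between 2 and 0 an odd number of times. -/
lemma sectorSign_square (i j k l : Fin 3) (hik : i ≠ k) (hjl : j ≠ l)
    (h1 : ¬ (i = j ∧ k = l)) (h2 : ¬ (i = l ∧ k = j)) :
    sectorSign i j + sectorSign j k + sectorSign k l + sectorSign l i = 1 := by
  revert i j k l; decide

/-- Equal sectors can only be consecutive, so the walk runs through the three sectors in blocks of
sizes 2, 2, 1 and winds once. -/
lemma sectorSign_pentagon (i j k l m : Fin 3) (hik : i ≠ k) (hjl : j ≠ l) (hkm : k ≠ m)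
    (hli : l ≠ i) (hmj : m ≠ j) :
    sectorSign i j + sectorSign j k + sectorSign k l + sectorSign l m + sectorSign m i = 1 := by
  revert i j k l m; decide

section Sector

variable {V L : Type*} [LinearOrder L] {col : V → Fin 3} {F : V → L}

lemma sectorGraph_adj_col_ne {u v : V} (h : (sectorGraph col F).Adj u v) : col u ≠ col v := by
  rcases h with ⟨h, -⟩ | ⟨h, -⟩ <;> rw [h] <;> simp

lemma sectorGraph_cliqueFree : (sectorGraph col F).CliqueFree 3 := by
  refine cliqueFree_three_iff_forall_adj.2 fun a b c hab hbc hca => ?_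
  have key (i j k : Fin 3) : ¬ (i = j + 1 ∧ i = k + 1 ∧ j = k + 1) := by
    revert i j k; decide
  rcases hab with ⟨h1, h1'⟩ | ⟨h1, h1'⟩ <;> rcases hbc with ⟨h2, h2'⟩ | ⟨h2, h2'⟩ <;>
    rcases hca with ⟨h3, h3'⟩ | ⟨h3, h3'⟩ <;> first | order | grind

/-- Vertices in consecutive sectors that are non-adjacent have decreasing heights. -/
lemma lt_of_compl_sectorGraph_adj (hF : ∀ u v, F u = F v → col u = col v) {u v : V}
    (h : ¬ (sectorGraph col F).Adj u v) (hc : col v = col u + 1) : F v < F u := by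
  rcases lt_trichotomy (F u) (F v) with h' | h' | h'
  · exact (h (Or.inl ⟨hc, h'⟩)).elim
  · have := hF _ _ h'
    rw [hc] at this
    simp at this
  · exact h'

/-- Edges raise the height in the cyclic direction and non-edges lower it, so an induced 2K₂ between
two sectors would give a cyclic chain of strict inequalities. -/
lemma sectorGraph_no_square (hF : ∀ u v, F u = F v → col u = col v) {a b c d : V}
    (hac : (sectorGraph col F).Adj a c) (hbd : (sectorGraph col F).Adj b d)
    (hbc : ¬ (sectorGraph col F).Adj b c) (hda : ¬ (sectorGraph col F).Adj d a)
    (h1 : col a = col b) (h2 : col c = col d) : False := by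
  have hcb := fun h => hbc (Adj.symm h)
  have had := fun h => hda (Adj.symm h)
  rcases hac with ⟨h3, h3'⟩ | ⟨h3, h3'⟩
  · have h4 := lt_of_compl_sectorGraph_adj hF hbc (by rw [h3, h1])
    have h5 := lt_of_compl_sectorGraph_adj hF had (by rw [← h2, h3])
    rcases hbd with ⟨h6, h6'⟩ | ⟨h6, h6'⟩
    · order
    · rw [← h1, ← h2, h3] at h6
      exact absurd h6 (by generalize col a = i; revert i; decide)
  · have h4 := lt_of_compl_sectorGraph_adj hF hcb (by rw [← h3, h1])
    have h5 := lt_of_compl_sectorGraph_adj hF hda (by rw [← h2, h3])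
    rcases hbd with ⟨h6, h6'⟩ | ⟨h6, h6'⟩
    · rw [← h1, ← h2, h3] at h6
      exact absurd h6 (by generalize col c = i; revert i; decide)
    · order

lemma sectorGraph_no_cotriangle (hF : ∀ u v, F u = F v → col u = col v) {a b c : V}
    (hab : ¬ (sectorGraph col F).Adj a b) (hbc : ¬ (sectorGraph col F).Adj b c)
    (hca : ¬ (sectorGraph col F).Adj c a) : col a = col b ∨ col b = col c ∨ col c = col a := by
  by_contra hne
  have hba := fun h => hab (Adj.symm h)
  have hcb := fun h => hbc (Adj.symm h)
  have hac := fun h => hca (Adj.symm h)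
  have key : ∀ i j k : Fin 3, ¬ (i = j ∨ j = k ∨ k = i) →
      (j = i + 1 ∧ k = j + 1 ∧ i = k + 1) ∨ (i = j + 1 ∧ j = k + 1 ∧ k = i + 1) := by decide
  rcases key _ _ _ hne with ⟨h1, h2, h3⟩ | ⟨h1, h2, h3⟩
  · have := lt_of_compl_sectorGraph_adj hF hab h1
    have := lt_of_compl_sectorGraph_adj hF hbc h2
    have := lt_of_compl_sectorGraph_adj hF hca h3
    order
  · have := lt_of_compl_sectorGraph_adj hF hba h1
    have := lt_of_compl_sectorGraph_adj hF hcb h2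
    have := lt_of_compl_sectorGraph_adj hF hac h3
    order

lemma sectorGraph_compl_antiEvenSignable (hF : ∀ u v, F u = F v → col u = col v) :
    (sectorGraph col F)ᶜ.AntiEvenSignable := by
  refine ⟨sectorLabeling _ col, isBalancing_antiEvenSign_iff.2 fun n f => ?_⟩
  have hsum : ∑ i, (sectorLabeling (sectorGraph col F)ᶜ col).value (f i) (f (i + 1)) =
      ∑ i, sectorSign (col (f i)) (col (f (i + 1))) :=
    Finset.sum_congr rfl fun i _ =>
      sectorLabeling_value col (f.map_adj_iff.2 (cycleGraph_adj_add_one i))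
  have hn {i j : Fin (n + 3)} (h : (cycleGraph (n + 3)).Adj i j) :
      ¬ (sectorGraph col F).Adj (f i) (f j) :=
    ((compl_adj _ _ _).1 (f.map_adj_iff.2 h)).2
  have ha {i j : Fin (n + 3)} (hij : i ≠ j) (h : ¬ (cycleGraph (n + 3)).Adj i j) :
      (sectorGraph col F).Adj (f i) (f j) := by
    by_contra h'
    exact h (f.map_adj_iff.1 ((compl_adj _ _ _).2 ⟨f.injective.ne hij, h'⟩))
  rw [hsum]
  match n with
  | 0 =>
    simpa [Fin.sum_univ_succ, add_assoc] using
      sectorSign_triangle (col (f 0)) (col (f 1)) (col (f 2))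
        (sectorGraph_no_cotriangle hF (hn (by decide)) (hn (by decide)) (hn (by decide)))
  | 1 =>
    have h02 := ha (i := 0) (j := 2) (by decide) (by decide)
    have h13 := ha (i := 1) (j := 3) (by decide) (by decide)
    have := sectorSign_square (col (f 0)) (col (f 1)) (col (f 2)) (col (f 3))
      (sectorGraph_adj_col_ne h02) (sectorGraph_adj_col_ne h13)
      (fun h => sectorGraph_no_square hF h02 h13 (hn (by decide)) (hn (by decide)) h.1 h.2)
      (fun h => sectorGraph_no_square hF h02 h13.symm (hn (by decide)) (hn (by decide)) h.1 h.2)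
    simpa [Fin.sum_univ_succ, add_assoc] using this
  | 2 =>
    have := sectorSign_pentagon (col (f 0)) (col (f 1)) (col (f 2)) (col (f 3)) (col (f 4))
      (sectorGraph_adj_col_ne (ha (by decide) (by decide)))
      (sectorGraph_adj_col_ne (ha (by decide) (by decide)))
      (sectorGraph_adj_col_ne (ha (by decide) (by decide)))
      (sectorGraph_adj_col_ne (ha (by decide) (by decide)))
      (sectorGraph_adj_col_ne (ha (by decide) (by decide)))
    simpa [Fin.sum_univ_succ, add_assoc] using this
  | m + 3 =>
    -- In an induced complement cycle of length at least 6, positions 0, 2, 4 are pairwise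
    -- non-consecutive and form a triangle of the sector graph.
    exfalso
    have hne {i j : Fin (m + 6)} (h : i.val + 2 ≤ j.val) (h' : j.val ≤ 4) :
        (sectorGraph col F).Adj (f i) (f j) := by
      refine ha (by rintro rfl; omega) ?_
      rw [cycleGraph_adj']
      rw [Fin.val_sub, Fin.val_sub]
      rintro (h1 | h1)
      · rw [Nat.mod_eq_of_lt (by omega)] at h1
        omega
      · rw [show m + 3 + 3 - i.val + j.val = (j.val - i.val) + (m + 3 + 3) by omega,
          Nat.add_mod_right, Nat.mod_eq_of_lt (by omega)] at h1
        omega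
    exact cliqueFree_three_iff_forall_adj.1 sectorGraph_cliqueFree
      (f ⟨0, by omega⟩) (f ⟨2, by omega⟩) (f ⟨4, by omega⟩)
      (hne (by simp) (by simp)) (hne (by simp) (by simp)) (hne (by simp) (by simp)).symm

end Sector

/-! ### From a circular colouring to a sector graph -/

/-- A graph with circular chromatic number less than `3` spans a triangle-free graph whose
complement is anti-even-signable. -/
lemma exists_le_of_circularChromaticNumber_lt_three {V : Type*} {G : SimpleGraph V}
    (hG : G.circularChromaticNumber < 3) :
    ∃ H : SimpleGraph V, G ≤ H ∧ H.CliqueFree 3 ∧ Hᶜ.AntiEvenSignable := by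
  simp only [circularChromaticNumber, iInf_lt_iff] at hG
  obtain ⟨r, ⟨hr1, c, hc, hadj⟩, hr3⟩ := hG
  have hr1 : (1 : ℝ) ≤ r := by exact_mod_cast hr1
  have hr3 : (r : ℝ) < 3 := by exact_mod_cast hr3
  have hr0 : (0 : ℝ) < r := by linarith
  set p : V → ℝ := fun v => 3 * c v / r with hp
  have hp0 (v) : 0 ≤ p v := by have := (hc v).1; positivity
  have hp3 (v) : p v < 3 := by
    rw [hp]; simp only; rw [div_lt_iff₀ hr0]; linarith [(hc v).2]
  have hfl (v) : ⌊p v⌋₊ < 3 := (Nat.floor_lt (hp0 v)).2 (by exact_mod_cast hp3 v)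
  let col : V → Fin 3 := fun v => ⟨⌊p v⌋₊, hfl v⟩
  -- The second coordinate only breaks ties, so that vertices in different sectors never share a
  -- height.
  let F : V → ℝ ×ₗ Fin 3 := fun v => toLex (p v - ⌊p v⌋₊, - col v)
  have hF (u v) (h : F u = F v) : col u = col v := by
    have := congrArg (fun x => (ofLex x).2) h
    simpa [F] using this
  have main {u v : V} (h1 : 1 < p v - p u) (h2 : p v - p u < 2) : (sectorGraph col F).Adj u v := by
    have e1 := Nat.floor_le (hp0 u)
    have e2 := Nat.lt_floor_add_one (p u)
    have e3 := Nat.floor_le (hp0 v)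
    have e4 := Nat.lt_floor_add_one (p v)
    -- The floors differ by 1 or 2; a difference of 2 is one step backwards modulo 3, and the
    -- fractional parts then compare the other way.
    have e5 : (⌊p u⌋₊ : ℝ) < ⌊p v⌋₊ := by linarith
    have e6 : (⌊p v⌋₊ : ℝ) < ⌊p u⌋₊ + 3 := by linarith
    have e5 : ⌊p u⌋₊ < ⌊p v⌋₊ := by exact_mod_cast e5
    have e6 : ⌊p v⌋₊ < ⌊p u⌋₊ + 3 := by exact_mod_cast e6
    rcases (by omega : ⌊p v⌋₊ = ⌊p u⌋₊ + 1 ∨ ⌊p v⌋₊ = ⌊p u⌋₊ + 2) with h | h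
    · left
      have hR : (⌊p v⌋₊ : ℝ) = ⌊p u⌋₊ + 1 := by exact_mod_cast h
      refine ⟨?_, Prod.Lex.toLex_lt_toLex.2 (Or.inl ?_)⟩
      · have := hfl v
        apply Fin.ext
        simp only [col, Fin.val_add]
        simp; omega
      · simp only; linarith
    · right
      have hR : (⌊p v⌋₊ : ℝ) = ⌊p u⌋₊ + 2 := by exact_mod_cast h
      refine ⟨?_, Prod.Lex.toLex_lt_toLex.2 (Or.inl ?_)⟩
      · have := hfl v
        apply Fin.ext
        simp only [col, Fin.val_add]
        simp; omega
      · simp only; linarith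
  refine ⟨sectorGraph col F, fun u v huv => ?_, sectorGraph_cliqueFree,
    sectorGraph_compl_antiEvenSignable hF⟩
  obtain ⟨h1, h2⟩ := hadj u v huv
  have hd (u v) : p u - p v = 3 * (c u - c v) / r := by simp only [hp]; ring
  rcases le_total (c u) (c v) with h | h
  · rw [abs_sub_comm, abs_of_nonneg (by linarith)] at h1 h2
    apply main <;> rw [hd]
    · rw [lt_div_iff₀ hr0]; linarith
    · rw [div_lt_iff₀ hr0]; linarith
  · rw [abs_of_nonneg (by linarith)] at h1 h2
    apply Adj.symm
    apply main <;> rw [hd]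
    · rw [lt_div_iff₀ hr0]; linarith
    · rw [div_lt_iff₀ hr0]; linarith

/-! ### From an acyclic orientation of the arcs to a circular colouring -/

section Arcs

variable {V : Type*} (H : SimpleGraph V) (col : V → Fin 3)

/-- The edges of `H` directed from each colour class to the cyclically next one. -/
def ColorArc (x y : V) : Prop := H.Adj x y ∧ col y = col x + 1

/-- Reachability by at most three consecutive arcs. -/
def ColorReach (x y : V) : Prop :=
  ColorArc H col x y ∨ (∃ a, ColorArc H col x a ∧ ColorArc H col a y) ∨
    ∃ a b, ColorArc H col x a ∧ ColorArc H col a b ∧ ColorArc H col b y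

variable {H col}

lemma not_colorReach_self (hH : H.CliqueFree 3) (x : V) : ¬ ColorReach H col x x := by
  rintro (⟨h, -⟩ | ⟨a, ⟨-, h⟩, -, h'⟩ | ⟨a, b, ⟨h, -⟩, ⟨h', -⟩, h'', -⟩)
  · exact h.ne rfl
  · have key (i j : Fin 3) : ¬ (j = i + 1 ∧ i = j + 1) := by revert i j; decide
    exact key _ _ ⟨h, h'⟩
  · exact cliqueFree_three_iff_forall_adj.1 hH _ _ _ h h' h''

/-- A path of four arcs starts and ends with arcs between the same two classes. By `h2` it either
shortcuts to a single arc or closes a triangle on its inner vertices, so three arcs already give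
full reachability. -/
lemma ColorArc.trans_colorReach (hH : H.CliqueFree 3)
    (h2 : ∀ x y x' y', ColorArc H col x y → ColorArc H col x' y' → col x = col x' →
      H.Adj x y' ∨ H.Adj x' y) {x y z : V} (hxy : ColorArc H col x y)
    (hyz : ColorReach H col y z) : ColorReach H col x z := by
  rcases hyz with h | ⟨a, h, h'⟩ | ⟨a, b, h, h', h''⟩
  · exact Or.inr (Or.inl ⟨y, hxy, h⟩)
  · exact Or.inr (Or.inr ⟨y, a, hxy, h, h'⟩)
  · have key (i j k l : Fin 3) : j = i + 1 → k = j + 1 → l = k + 1 → i = l := by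
      revert i j k l; decide
    have hcol := key _ _ _ _ hxy.2 h.2 h'.2
    rcases h2 _ _ _ _ hxy h'' hcol with h3 | h3
    · exact Or.inl ⟨h3, by rw [h''.2, hcol]⟩
    · exact (cliqueFree_three_iff_forall_adj.1 hH _ _ _ h.1 h'.1 h3).elim

/-- The arcs between the colour classes strictly decrease some natural number. -/
lemma exists_lt_of_colorArc [Finite V] (hH : H.CliqueFree 3)
    (h2 : ∀ x y x' y', ColorArc H col x y → ColorArc H col x' y' → col x = col x' →
      H.Adj x y' ∨ H.Adj x' y) :
    ∃ (M : ℕ) (N : V → ℕ), (∀ v, N v ≤ M) ∧ ∀ x y, ColorArc H col x y → N y < N x := by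
  -- Along an arc the reachable set shrinks strictly: the head is reachable from the tail but not
  -- from itself.
  refine ⟨Nat.card V, fun v => {w | ColorReach H col v w}.ncard, fun v => Set.ncard_le_card _,
    fun x y hxy => Set.ncard_lt_ncard ?_⟩
  refine ⟨fun z hz => hxy.trans_colorReach hH h2 hz, fun h => ?_⟩
  exact not_colorReach_self hH y (h (Or.inl hxy))

/-- Each class gets a sector of length `m = M + 1`, and `v` is placed `M - N v` into its sector. The
drop of `N` along an arc separates its ends by at least `m + 1` on a circle of length `3 * m`;
dividing by `m + 1` yields `r = 3 * m / (m + 1) < 3`. -/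
lemma circularChromaticNumber_lt_three_of_color_arc_lt {M : ℕ} {N : V → ℕ}
    (hcol : ∀ x y, H.Adj x y → col x ≠ col y) (hM : ∀ v, N v ≤ M)
    (hN : ∀ x y, ColorArc H col x y → N y < N x) : H.circularChromaticNumber < 3 := by
  set m : ℝ := M + 1 with hm
  have hm0 : 1 ≤ m := by simp [hm]
  -- The colour of `v`, before rescaling a circle of length `3 * m` to length `3 * m / (m + 1)`.
  let p : V → ℝ := fun v => m * ((col v : ℕ) : ℝ) + (M - N v)
  have hMR (v) : (N v : ℝ) ≤ M := by exact_mod_cast hM v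
  have hp0 (v) : 0 ≤ p v := by have := hMR v; simp only [p]; positivity [sub_nonneg.2 this]
  have hp3 (v) : p v < 3 * m := by
    have h1 : ((col v : ℕ) : ℝ) ≤ 2 := by exact_mod_cast Nat.le_of_lt_succ (col v).2
    have h2 : (0 : ℝ) ≤ N v := by positivity
    simp only [p]
    nlinarith
  have harc {x y : V} (h : ColorArc H col x y) : m + 1 ≤ |p x - p y| ∧ |p x - p y| ≤ 2 * m - 1 := by
    have h1 : (N y : ℝ) + 1 ≤ N x := by exact_mod_cast hN x y h
    have h2 : (N x : ℝ) ≤ m - 1 := by simpa [hm] using hMR x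
    have h3 : (0 : ℝ) ≤ N y := by positivity
    have key (i j : Fin 3) : j = i + 1 → (j : ℕ) = i + 1 ∨ (j : ℕ) + 2 = i := by
      revert i j; decide
    rcases key _ _ h.2 with h4 | h4
    · have h4 : ((col y : ℕ) : ℝ) = (col x : ℕ) + 1 := by exact_mod_cast h4
      have h5 : p x - p y = -(m + (N x - N y)) := by simp only [p, h4]; ring
      rw [h5, abs_neg, abs_of_nonneg (by linarith)]
      constructor <;> linarith
    · have h4 : ((col x : ℕ) : ℝ) = (col y : ℕ) + 2 := by exact_mod_cast h4.symm
      have h5 : p x - p y = 2 * m - (N x - N y) := by simp only [p, h4]; ring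
      rw [h5, abs_of_nonneg (by linarith)]
      constructor <;> linarith
  have hadj {x y : V} (h : H.Adj x y) : m + 1 ≤ |p x - p y| ∧ |p x - p y| ≤ 2 * m - 1 := by
    have key (i j : Fin 3) : i ≠ j → j = i + 1 ∨ i = j + 1 := by revert i j; decide
    rcases key _ _ (hcol x y h) with h' | h'
    · exact harc ⟨h, h'⟩
    · rw [abs_sub_comm]
      exact harc ⟨h.symm, h'⟩
  have hm1 : 0 < m + 1 := by linarith
  let r : ℝ≥0 := ⟨3 * m / (m + 1), by positivity⟩
  have hr : (r : ℝ) = 3 * m / (m + 1) := rfl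
  have hr3 : (r : ℝ≥0∞) < 3 := by
    have : (r : ℝ) < 3 := by rw [hr, div_lt_iff₀ hm1]; linarith
    exact_mod_cast this
  refine lt_of_le_of_lt (iInf₂_le r ⟨?_, fun v => p v / (m + 1), fun v => ⟨?_, ?_⟩, fun x y h => ?_⟩)
    hr3
  · rw [← NNReal.coe_le_coe, hr, le_div_iff₀ hm1]
    push_cast
    linarith
  · exact div_nonneg (hp0 v) hm1.le
  · rw [hr]
    exact div_lt_div_of_pos_right (hp3 v) hm1
  · obtain ⟨h1, h2⟩ := hadj h
    have h3 : p x / (m + 1) - p y / (m + 1) = (p x - p y) / (m + 1) := by ring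
    rw [h3, abs_div, abs_of_pos hm1, hr]
    constructor
    · rwa [le_div_iff₀ hm1, one_mul]
    · rw [div_le_iff₀ hm1, sub_mul, div_mul_cancel₀ _ hm1.ne']
      linarith

end Arcs

/-! ### From a signing of the complement to a 3-colouring -/

section Signed

variable {V : Type*} {H : SimpleGraph V}

/-- A symmetric function whose sums are `0` on the triangles of the complement of `H` and `1` on
its induced cycles of length four and five. -/
structure IsCoSign (H : SimpleGraph V) (l : V → V → ZMod 2) : Prop where
  comm : ∀ a b, l a b = l b a
  triangle : ∀ {a b c}, Hᶜ.Adj a b → Hᶜ.Adj b c → Hᶜ.Adj c a → l a b + l b c + l c a = 0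
  square : ∀ {a b c d}, Hᶜ.Adj a b → Hᶜ.Adj b c → Hᶜ.Adj c d → Hᶜ.Adj d a → H.Adj a c →
    H.Adj b d → l a b + l b c + l c d + l d a = 1
  pentagon : ∀ {a b c d e}, Hᶜ.Adj a b → Hᶜ.Adj b c → Hᶜ.Adj c d → Hᶜ.Adj d e → Hᶜ.Adj e a →
    H.Adj a c → H.Adj b d → H.Adj c e → H.Adj d a → H.Adj e b →
    l a b + l b c + l c d + l d e + l e a = 1

lemma IsBalancing.isCoSign {σ : Hᶜ.EdgeLabeling (ZMod 2)}
    (hσ : IsBalancing (antiEvenSign Hᶜ) σ) : IsCoSign H σ.value where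
  comm := σ.value_comm
  triangle := hσ.triangle
  square := fun h1 h2 h3 h4 h5 h6 => hσ.square h1 h2 h3 h4 (by rwa [compl_compl])
    (by rwa [compl_compl])
  pentagon := fun h1 h2 h3 h4 h5 h6 h7 h8 h9 h10 => hσ.pentagon h1 h2 h3 h4 h5
    (by rwa [compl_compl]) (by rwa [compl_compl]) (by rwa [compl_compl]) (by rwa [compl_compl])
    (by rwa [compl_compl])

/-- Switching preserves all cycle sums. -/
lemma IsCoSign.switch {l : V → V → ZMod 2} (hl : IsCoSign H l) (s : V → ZMod 2) :
    IsCoSign H fun a b => l a b + s a + s b where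
  comm a b := by rw [hl.comm a b]; ring
  triangle {a b c} h1 h2 h3 := by
    rw [← hl.triangle h1 h2 h3]
    linear_combination CharTwo.add_self_eq_zero (s a) + CharTwo.add_self_eq_zero (s b) +
      CharTwo.add_self_eq_zero (s c)
  square {a b c d} h1 h2 h3 h4 h5 h6 := by
    rw [← hl.square h1 h2 h3 h4 h5 h6]
    linear_combination CharTwo.add_self_eq_zero (s a) + CharTwo.add_self_eq_zero (s b) +
      CharTwo.add_self_eq_zero (s c) + CharTwo.add_self_eq_zero (s d)
  pentagon {a b c d e} h1 h2 h3 h4 h5 h6 h7 h8 h9 h10 := by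
    rw [← hl.pentagon h1 h2 h3 h4 h5 h6 h7 h8 h9 h10]
    linear_combination CharTwo.add_self_eq_zero (s a) + CharTwo.add_self_eq_zero (s b) +
      CharTwo.add_self_eq_zero (s c) + CharTwo.add_self_eq_zero (s d) +
      CharTwo.add_self_eq_zero (s e)

/-- A co-sign can be switched to vanish on the pairs containing `v` and on those inside the
neighbourhood of `v`. -/
lemma IsCoSign.exists_normalized (hH : H.CliqueFree 3) {l : V → V → ZMod 2} (hl : IsCoSign H l)
    (hself : ∀ u, l u u = 0) (v : V) :
    ∃ l', IsCoSign H l' ∧ (∀ u, Hᶜ.Adj v u → l' v u = 0) ∧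
      ∀ c c', H.Adj v c → H.Adj v c' → c ≠ c' → l' c c' = 0 := by
  classical
  by_cases hv : ∃ c₀, H.Adj v c₀
  · obtain ⟨c₀, hc₀⟩ := hv
    -- The neighbours of `v` form a clique in the complement. This switch kills the labels at `c₀`
    -- inside it, and triangles through `c₀` kill the rest.
    set s : V → ZMod 2 := fun u => if H.Adj v u then l c₀ u else l v u with hs
    have hl' := hl.switch s
    have hc (c) (hc : H.Adj v c) : l c₀ c + s c₀ + s c = 0 := by
      simp [hs, hc₀, hc, hself, CharTwo.add_self_eq_zero]
    have hK {a b} (ha : H.Adj v a) (hb : H.Adj v b) (hab : a ≠ b) : Hᶜ.Adj a b :=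
      (compl_adj _ _ _).2 ⟨hab, fun h => cliqueFree_three_iff_forall_adj.1 hH _ _ _ ha h hb.symm⟩
    refine ⟨_, hl', fun u hu => ?_, fun c c' h h' hne => ?_⟩
    · simp [hs, ((compl_adj _ _ _).1 hu).2, hself, CharTwo.add_self_eq_zero]
    · by_cases h1 : c = c₀
      · rw [h1]; exact hc c' h'
      by_cases h2 : c' = c₀
      · rw [hl'.comm, h2]; exact hc c h
      have := hl'.triangle (hK hc₀ h (Ne.symm h1)) (hK h h' hne) (hK h' hc₀ h2)
      rw [hl'.comm c' c₀, hc c h, hc c' h'] at this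
      simpa using this
  · refine ⟨_, hl.switch (l v), fun u hu => ?_, fun c _ h => (hv ⟨c, h⟩).elim⟩
    simp [hself, CharTwo.add_self_eq_zero]

/-- The labels of the pairs of non-adjacent vertices with given colours. -/
def classSign (i j : Fin 3) : ZMod 2 := if (i = 1 ∧ j = 2) ∨ (i = 2 ∧ j = 1) then 1 else 0

lemma classSign_square (i j : Fin 3) :
    classSign i i + classSign i j + classSign j j + classSign j i = 0 := by
  revert i j; decide

/-- A proper colouring of `H` with three colours such that the co-sign depends only on colours. -/
lemma IsCoSign.exists_coloring [Finite V] [Nonempty V] (hH : H.CliqueFree 3)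
    {l₀ : V → V → ZMod 2} (hl₀ : IsCoSign H l₀) (hself : ∀ u, l₀ u u = 0) :
    ∃ (l : V → V → ZMod 2) (col : V → Fin 3), IsCoSign H l ∧
      (∀ x y, H.Adj x y → col x ≠ col y) ∧
      ∀ x y, Hᶜ.Adj x y → l x y = classSign (col x) (col y) := by
  classical
  have htri := cliqueFree_three_iff_forall_adj.1 hH
  obtain ⟨v, hv⟩ := Finite.exists_max fun v => (H.neighborSet v).ncard
  obtain ⟨l, hl, hlv, hlc⟩ := hl₀.exists_normalized hH hself v
  have hK {a b : V} (h : a ≠ b) (h' : ¬ H.Adj a b) : Hᶜ.Adj a b := (compl_adj _ _ _).2 ⟨h, h'⟩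
  have hout {u w : V} (hu : ¬ H.Adj v u) (hw : ¬ H.Adj v w) (huw : Hᶜ.Adj u w) : l u w = 0 := by
    by_cases h1 : v = u
    · subst h1; exact hlv _ huw
    by_cases h2 : v = w
    · subst h2; rw [hl.comm]; exact hlv _ huw.symm
    have := hl.triangle (hK h1 hu) huw (hK h2 hw).symm
    rwa [hl.comm w v, hlv _ (hK h1 hu), hlv _ (hK h2 hw), zero_add, add_zero] at this
  -- The label from `u` to its non-neighbours inside the neighbourhood of `v` is a single value,
  -- which will determine the class of `u`.
  have hsame {u c c' : V} (hc : H.Adj v c) (hc' : H.Adj v c') (h : Hᶜ.Adj u c)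
      (h' : Hᶜ.Adj u c') : l u c = l u c' := by
    by_cases hcc : c = c'
    · rw [hcc]
    have := hl.triangle h (hK hcc fun h => htri _ _ _ hc h hc'.symm) h'.symm
    rw [hlc c c' hc hc' hcc, add_zero, hl.comm c' u] at this
    exact CharTwo.add_eq_zero.1 this
  -- An edge `u u'` with equal values would close an induced complement square or pentagon through
  -- `v` whose labels sum to 0.
  have hclique {u u' c c' : V} (hu : ¬ H.Adj v u) (hu' : ¬ H.Adj v u') (hc : H.Adj v c)
      (hc' : H.Adj v c') (h : Hᶜ.Adj u c) (h' : Hᶜ.Adj u' c') (heq : l u c = l u' c') :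
      ¬ H.Adj u u' := by
    intro huu
    have hv1 : v ≠ u := by rintro rfl; exact ((compl_adj _ _ _).1 h).2 hc
    have hv2 : v ≠ u' := by rintro rfl; exact ((compl_adj _ _ _).1 h').2 hc'
    have hvu := hK hv1 hu
    have hvu' := hK hv2 hu'
    by_cases h1 : Hᶜ.Adj u c'
    · have := hl.square h1 h'.symm hvu'.symm hvu huu hc'.symm
      rw [hlv _ hvu, hl.comm u' v, hlv _ hvu', hl.comm c' u', ← heq, hsame hc' hc h1 h,
        CharTwo.add_self_eq_zero] at this
      simp at this
    by_cases h2 : Hᶜ.Adj u' c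
    · have := hl.square h h2.symm hvu'.symm hvu huu hc.symm
      rw [hlv _ hvu, hl.comm u' v, hlv _ hvu', hl.comm c u', hsame hc hc' h2 h', ← heq,
        CharTwo.add_self_eq_zero] at this
      simp at this
    have hcc : c ≠ c' := by rintro rfl; exact h1 h
    have hadj {a b : V} (h : ¬ Hᶜ.Adj a b) (hab : a ≠ b) : H.Adj a b := by
      by_contra h3; exact h (hK hab h3)
    have h3 := hadj h1 (by rintro rfl; exact hu hc')
    have h4 := hadj h2 (by rintro rfl; exact hu' hc)
    have := hl.pentagon h (hK hcc fun h => htri _ _ _ hc h hc'.symm) h'.symm hvu'.symm hvu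
      h3 h4.symm hc'.symm huu.symm hc
    rw [hlv _ hvu, hl.comm u' v, hlv _ hvu', hl.comm c' u', ← heq, hlc _ _ hc hc' hcc, add_zero,
      add_zero, add_zero, CharTwo.add_self_eq_zero] at this
    simp at this
  let P : V → Prop := fun u => ∃ c, H.Adj v c ∧ Hᶜ.Adj u c ∧ l u c = 1
  let col : V → Fin 3 := fun u => if H.Adj v u then 1 else if P u then 2 else 0
  have hcol1 {u} (hu : H.Adj v u) : col u = 1 := by simp [col, hu]
  have hcol2 {u} (hu : ¬ H.Adj v u) (hP : P u) : col u = 2 := by simp [col, hu, hP]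
  have hcol0 {u} (hu : ¬ H.Adj v u) (hP : ¬ P u) : col u = 0 := by simp [col, hu, hP]
  have hcross {u c : V} (hu : ¬ H.Adj v u) (hc : H.Adj v c) (h : Hᶜ.Adj u c) :
      l u c = classSign (col u) (col c) := by
    by_cases hP : P u
    · obtain ⟨c', hc', h', h1⟩ := id hP
      rw [hcol1 hc, hcol2 hu hP, hsame hc hc' h h', h1]
      decide
    · rw [hcol1 hc, hcol0 hu hP]
      have key (x : ZMod 2) : x ≠ 1 → x = classSign 0 1 := by revert x; decide
      exact key _ fun h1 => hP ⟨c, hc, h, h1⟩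
  refine ⟨l, col, hl, fun x y hxy heq => ?_, fun x y hxy => ?_⟩
  · by_cases hx : H.Adj v x
    · by_cases hy : H.Adj v y
      · exact htri _ _ _ hx hxy hy.symm
      · rw [hcol1 hx] at heq
        by_cases hP : P y
        · rw [hcol2 hy hP] at heq; exact absurd heq (by decide)
        · rw [hcol0 hy hP] at heq; exact absurd heq (by decide)
    by_cases hy : H.Adj v y
    · rw [hcol1 hy] at heq
      by_cases hP : P x
      · rw [hcol2 hx hP] at heq; exact absurd heq (by decide)
      · rw [hcol0 hx hP] at heq; exact absurd heq (by decide)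
    -- A vertex joined to all neighbours of `v` has no further neighbours, by maximality.
    have htwin {u w : V} (hw : ¬ H.Adj v w) (huw : H.Adj u w) : ∃ c, H.Adj v c ∧ ¬ H.Adj u c := by
      by_contra! hall
      have hss : H.neighborSet v ⊂ H.neighborSet u := ⟨fun c hc => hall c hc, fun h => hw (h huw)⟩
      exact absurd (hv u) (not_le.2 (Set.ncard_lt_ncard hss))
    obtain ⟨c, hc, hxc⟩ := htwin hy hxy
    obtain ⟨c', hc', hyc⟩ := htwin hx hxy.symm
    have hxc := hK (by rintro rfl; exact hx hc) hxc
    have hyc := hK (by rintro rfl; exact hy hc') hyc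
    refine hclique hx hy hc hc' hxc hyc ?_ hxy
    rw [hcross hx hc hxc, hcross hy hc' hyc, heq, hcol1 hc, hcol1 hc']
  · by_cases hx : H.Adj v x
    · by_cases hy : H.Adj v y
      · rw [hlc _ _ hx hy hxy.ne, hcol1 hx, hcol1 hy]; decide
      · have key (i j : Fin 3) : classSign i j = classSign j i := by revert i j; decide
        rw [hl.comm, key, hcross hy hx hxy.symm]
    by_cases hy : H.Adj v y
    · exact hcross hx hy hxy
    · rw [hout hx hy hxy]
      have key (i j : Fin 3) : i ≠ 1 → j ≠ 1 → 0 = classSign i j := by revert i j; decide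
      refine key _ _ ?_ ?_ <;> simp only [col, hx, hy, if_false] <;> split_ifs <;> decide

end Signed

/-! ### The converse for finite graphs, and maximality -/

/-- Finite triangle-free graphs with anti-even-signable complement have circular chromatic number
less than `3`. -/
lemma circularChromaticNumber_lt_three {V : Type*} [Finite V] {H : SimpleGraph V}
    (hH : H.CliqueFree 3) (hs : Hᶜ.AntiEvenSignable) : H.circularChromaticNumber < 3 := by
  suffices h : ∃ col : V → Fin 3, (∀ x y, H.Adj x y → col x ≠ col y) ∧
      ∀ x y x' y', ColorArc H col x y → ColorArc H col x' y' → col x = col x' →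
        H.Adj x y' ∨ H.Adj x' y by
    obtain ⟨col, hcol, h2⟩ := h
    obtain ⟨M, N, hM, hN⟩ := exists_lt_of_colorArc hH h2
    exact circularChromaticNumber_lt_three_of_color_arc_lt hcol hM hN
  rcases isEmpty_or_nonempty V with hV | hV
  · exact ⟨isEmptyElim, isEmptyElim, isEmptyElim⟩
  obtain ⟨σ, hσ⟩ := hs
  obtain ⟨l, col, hl, hcol, hlcol⟩ := hσ.isCoSign.exists_coloring hH σ.value_self
  refine ⟨col, hcol, fun x y x' y' h h' hx => ?_⟩
  by_contra! hn
  have hy : col y = col y' := by rw [h.2, h'.2, hx]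
  have hxx : Hᶜ.Adj x x' := (compl_adj _ _ _).2
    ⟨by rintro rfl; exact hn.1 h'.1, fun h => hcol _ _ h hx⟩
  have hyy : Hᶜ.Adj y y' := (compl_adj _ _ _).2
    ⟨by rintro rfl; exact hn.1 h.1, fun h => hcol _ _ h hy⟩
  have hne : col x ≠ col y := by rw [h.2]; simp
  have hxy : Hᶜ.Adj y' x := (compl_adj _ _ _).2
    ⟨by rintro rfl; exact hne hy.symm, fun h => hn.1 h.symm⟩
  have hxy' : Hᶜ.Adj x' y := (compl_adj _ _ _).2 ⟨by rintro rfl; exact hne hx, hn.2⟩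
  -- The complement square `x x' y y'` has colours `i, i, j, j`: the two cross labels cancel and the
  -- other two vanish, so the sum is 0 instead of 1.
  have := hl.square hxx hxy' hyy hxy h.1 h'.1
  rw [hlcol _ _ hxx, hlcol _ _ hxy', hlcol _ _ hyy, hlcol _ _ hxy, ← hx, ← hy,
    classSign_square] at this
  exact absurd this (by decide)

lemma circularChromaticNumber_mono {V : Type*} {G H : SimpleGraph V} (h : G ≤ H) :
    G.circularChromaticNumber ≤ H.circularChromaticNumber :=
  le_iInf₂ fun r ⟨hr, c, hc, hadj⟩ =>
    iInf₂_le r ⟨hr, c, hc, fun u v huv => hadj u v (h huv)⟩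

end SimpleGraph

/-- Here `P` is the downward closure of `Q`, and passing to a downward closure does not change the
maximal elements. -/
theorem maximal_iff_of_forall_iff_exists_le {α : Type*} [PartialOrder α] {P Q : α → Prop}
    (h : ∀ a, P a ↔ ∃ b, a ≤ b ∧ Q b) (a : α) : Maximal P a ↔ Maximal Q a := by
  have hQP {b} (hb : Q b) : P b := (h b).2 ⟨b, le_rfl, hb⟩
  constructor
  · intro ha
    obtain ⟨b, hab, hb⟩ := (h a).1 ha.prop
    obtain rfl := ha.eq_of_le (hQP hb) hab
    exact ⟨hb, fun c hc hbc => ha.le_of_ge (hQP hc) hbc⟩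
  · refine fun ha => ⟨hQP ha.prop, fun c hc hac => ?_⟩
    obtain ⟨b, hcb, hb⟩ := (h c).1 hc
    exact hcb.trans (ha.le_of_ge hb (hac.trans hcb))

theorem theorem2 {V : Type*} [Countable V] (G : SimpleGraph V) :
    (G.circularChromaticNumber < 3 →
      ∃ H : SimpleGraph V, G ≤ H ∧ H.CliqueFree 3 ∧ Hᶜ.AntiEvenSignable) ∧
    (Finite V →
      (G.circularChromaticNumber < 3 ↔
        ∃ H : SimpleGraph V, G ≤ H ∧ H.CliqueFree 3 ∧ Hᶜ.AntiEvenSignable) ∧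
      (Maximal (fun H : SimpleGraph V => H.circularChromaticNumber < 3) G ↔
        Maximal (fun H : SimpleGraph V => H.CliqueFree 3 ∧ Hᶜ.AntiEvenSignable) G)) := by
  refine ⟨SimpleGraph.exists_le_of_circularChromaticNumber_lt_three, fun _ => ?_⟩
  have key (G : SimpleGraph V) : G.circularChromaticNumber < 3 ↔
      ∃ H : SimpleGraph V, G ≤ H ∧ H.CliqueFree 3 ∧ Hᶜ.AntiEvenSignable :=
    ⟨SimpleGraph.exists_le_of_circularChromaticNumber_lt_three, fun ⟨_, hGH, hH, hs⟩ =>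
      (SimpleGraph.circularChromaticNumber_mono hGH).trans_lt
        (SimpleGraph.circularChromaticNumber_lt_three hH hs)⟩
  exact ⟨key G, maximal_iff_of_forall_iff_exists_le key G⟩
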